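/- Let $\log$ denote the base-2 logarithm, with the convention $0\log 0=0$. Let $n\ge 1$, let $f$ be a log-concave probability density on $\mathbb{R}^n$ (that is, $\log f$, with values in $[-\infty,\infty)$, is concave), and let $h(X^n)=-\int_{\mathbb{R}^n} f\log f\,dx$ be the differential entropy of a random vector $X^n\sim f$. For $\zeta\in(0,1]$ let $$\tilde h_\zeta(X^n)=\int_{\mathbb{R}^n}-\zeta^{-1}\min\{\xi,f(x)\}\,\log\bigl(\zeta^{-1}\min\{\xi,f(x)\}\bigr)\,dx,$$ where $\xi>0$ is such that $\int_{\mathbb{R}^n}\min\{\xi,f(x)\}\,dx=\zeta$. Let $\Gamma(a,z)=\int_z^\infty t^{a-1}e^{-t}\,dt$ and $\Gamma(a)=\Gamma(a,0)$. Then such a $\xi$ exists, both entropy integrals converge absolutely, there is a $\nu\ge 0$ with $\Gamma(n+1,\nu)=\zeta\,\Gamma(n+1)$, and every such $\nu$ satisfies $$\tilde h_\zeta(X^n)-h(X^n)\le\log\zeta+\nu\log e+n\log e.$$ Moreover, if $\zeta\ge e^{-(e-2)n}$, then $$\tilde h_\zeta(X^n)-h(X^n)\le\log\zeta+(e+\log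 e)\,n.$$ -/

import Mathlib

open MeasureTheory

noncomputable section

/-- `f` is a probability density function on `ℝⁿ` (with respect to Lebesgue measure). -/
structure IsPdf {n : ℕ} (f : (Fin n → ℝ) → ℝ) : Prop where
  nonneg : ∀ x, 0 ≤ f x
  integrable : Integrable f
  integral_eq_one : ∫ x, f x = 1

/-- A nonnegative `f` is log-concave: `log f`, with `log 0 = -∞`, is concave on `ℝⁿ`; that is,
`{f > 0}` is convex and `log f` is concave on it. -/
def LogConcave {n : ℕ} (f : (Fin n → ℝ) → ℝ) : Prop :=
  ConcaveOn ℝ {x | 0 < f x} (fun x => Real.log (f x))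

/-- The integrand `-f log f` of the differential entropy, in bits (with `0 log 0 = 0`). -/
def entropyIntegrand {n : ℕ} (f : (Fin n → ℝ) → ℝ) (x : Fin n → ℝ) : ℝ :=
  -(f x * Real.logb 2 (f x))

/-- Differential entropy, in bits, of a random vector with density `f`. -/
def diffEntropy {n : ℕ} (f : (Fin n → ℝ) → ℝ) : ℝ :=
  ∫ x, entropyIntegrand f x

/-- `ξ > 0` is a level at which truncating `f` leaves mass `ζ`. -/
def IsTruncationLevel {n : ℕ} (f : (Fin n → ℝ) → ℝ) (ζ ξ : ℝ) : Prop :=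
  0 < ξ ∧ ∫ x, min ξ (f x) = ζ

open Classical in
/-- A truncation level for `f` and `ζ`. For a density `f` it is unique if `0 < ζ < 1`; if `ζ = 1`
every level is an almost everywhere upper bound of `f`, so that `min ξ f = f` almost everywhere
whichever level is chosen. The value `0` is used only if there is no level. -/
def truncationLevel {n : ℕ} (f : (Fin n → ℝ) → ℝ) (ζ : ℝ) : ℝ :=
  if h : ∃ ξ, IsTruncationLevel f ζ ξ then h.choose else 0

/-- The truncated and renormalized density `ζ⁻¹ min {ξ, f}`. -/
def truncatedDensity {n : ℕ} (f : (Fin n → ℝ) → ℝ) (ζ : ℝ) (x : Fin n → ℝ) : ℝ :=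
  ζ⁻¹ * min (truncationLevel f ζ) (f x)

/-- Truncated differential entropy
`∫ -ζ⁻¹ min {ξ, f} log (ζ⁻¹ min {ξ, f})`, in bits. -/
def truncatedDiffEntropy {n : ℕ} (f : (Fin n → ℝ) → ℝ) (ζ : ℝ) : ℝ :=
  diffEntropy (truncatedDensity f ζ)

/-- The (upper) incomplete gamma function `Γ(a, z) = ∫_z^∞ t^(a-1) e^(-t) dt`. -/
def upperIncompleteGamma (a z : ℝ) : ℝ :=
  ∫ t in Set.Ioi z, t ^ (a - 1) * Real.exp (-t)

end

open MeasureTheory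

/-! Let `M = sup f` and `V(s) = vol {f > M e⁻ˢ}`. Log-concavity makes `V(s) / sⁿ` antitone
(`IsPdf.superlevelVolume_mul_pow_le`). By the layer-cake formula, truncating at `M e⁻ʳ` leaves mass
`M ∫_r^∞ e⁻ˢ V(s) ds = ζ`, and the truncated entropy, in nats, is `log (ζ / M) - 1` plus the mean of
the law proportional to `e⁻ˢ V(s)` on `(r, ∞)`.

Let `G` have density proportional to `sⁿ e⁻ˢ` and let `P(G > ν) = ζ`. The antitone ratio gives `P(G
> r) ≥ ζ`, hence `r ≤ ν` (`integral_Ioi_le_gammaTail_mul`), and bounds the mean above by `E[G | G >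
r] ≤ E[G | G > ν]` (`integral_Ioi_mul_le_gammaTailMean_mul`, `gammaTailMean_mono`). Since `h(f) ≥
-log M`, the entropy gap is at most `log ζ + E[G | G > ν] - 1` nats
(`IsPdf.truncatedDiffEntropy_sub_le`).

The first bound is then `E[G | G > ν] ≤ 1 + n + ν`. The second needs more than the Chernoff bound `ν
≤ e n`: the conditional mean itself is estimated at `e n`, with `n = 1, 2` treated separately. -/

/-- The upper tail `e⁻ˣ ∑_{k ≤ n} xᵏ / k!` of the Gamma distribution with shape `n + 1`. -/
noncomputable def gammaTail (n : ℕ) (x : ℝ) : ℝ :=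
  Real.exp (-x) * ∑ k ∈ Finset.range (n + 1), x ^ k / (k.factorial : ℝ)

/-! ### Gamma tails, their conditional means, and numerical bounds. -/

section GammaTail

open Filter Topology Set

theorem gammaTail_succ (n : ℕ) (x : ℝ) :
    gammaTail (n + 1) x = gammaTail n x + Real.exp (-x) * (x ^ (n + 1) / ((n + 1).factorial : ℝ)) := by
  simp only [gammaTail]
  rw [Finset.sum_range_succ _ (n + 1), mul_add]

theorem gammaTail_zero_left (x : ℝ) : gammaTail 0 x = Real.exp (-x) := by simp [gammaTail]

theorem gammaTail_zero_right (n : ℕ) : gammaTail n 0 = 1 := by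
  induction n with
  | zero => simp [gammaTail]
  | succ n ih => rw [gammaTail_succ, ih]; simp

/-- The derivative telescopes: each new term cancels what the previous ones leave. -/
theorem hasDerivAt_gammaTail (n : ℕ) (x : ℝ) :
    HasDerivAt (gammaTail n) (-(Real.exp (-x) * (x ^ n / (n.factorial : ℝ)))) x := by
  have hexp : HasDerivAt (fun y : ℝ => Real.exp (-y)) (-Real.exp (-x)) x := by
    simpa using (hasDerivAt_neg x).exp
  induction n with
  | zero =>
    have h : gammaTail 0 = fun y : ℝ => Real.exp (-y) := funext gammaTail_zero_left
    rw [h]; simpa using hexp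
  | succ n ih =>
    have h : gammaTail (n + 1) = fun y => gammaTail n y +
        Real.exp (-y) * (y ^ (n + 1) / ((n + 1).factorial : ℝ)) := funext (gammaTail_succ n)
    rw [h]
    have h2 := ih.add (hexp.mul ((hasDerivAt_pow (n + 1) x).div_const ((n + 1).factorial : ℝ)))
    refine h2.congr_deriv ?_
    have : (n.factorial : ℝ) ≠ 0 := by positivity
    rw [Nat.factorial_succ]
    push_cast
    field_simp
    simp

theorem continuous_gammaTail (n : ℕ) : Continuous (gammaTail n) :=
  continuous_iff_continuousAt.2 fun x => (hasDerivAt_gammaTail n x).continuousAt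

theorem tendsto_gammaTail (n : ℕ) : Tendsto (gammaTail n) atTop (𝓝 0) := by
  induction n with
  | zero =>
    have h : gammaTail 0 = fun y : ℝ => Real.exp (-y) := funext gammaTail_zero_left
    rw [h]; exact Real.tendsto_exp_neg_atTop_nhds_zero
  | succ n ih =>
    have h : gammaTail (n + 1) = fun y => gammaTail n y +
        (y ^ (n + 1) * Real.exp (-y)) / ((n + 1).factorial : ℝ) :=
      funext fun y => by rw [gammaTail_succ]; ring
    rw [h]
    simpa using ih.add
      ((Real.tendsto_pow_mul_exp_neg_atTop_nhds_zero (n + 1)).div_const ((n + 1).factorial : ℝ))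

theorem strictAntiOn_gammaTail (n : ℕ) : StrictAntiOn (gammaTail n) (Ici 0) := by
  refine strictAntiOn_of_deriv_neg (convex_Ici 0) (continuous_gammaTail n).continuousOn ?_
  intro x hx
  rw [interior_Ici, mem_Ioi] at hx
  rw [(hasDerivAt_gammaTail n x).deriv]
  have : 0 < Real.exp (-x) * (x ^ n / (n.factorial : ℝ)) := by positivity
  linarith

theorem gammaTail_pos (n : ℕ) {x : ℝ} (hx : 0 ≤ x) : 0 < gammaTail n x := by
  unfold gammaTail
  refine mul_pos (Real.exp_pos _) ?_
  rw [Finset.sum_range_succ']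
  have : 0 ≤ ∑ k ∈ Finset.range n, x ^ (k + 1) / ((k + 1).factorial : ℝ) :=
    Finset.sum_nonneg fun k _ => by positivity
  simp only [pow_zero, Nat.factorial_zero, Nat.cast_one]
  linarith

theorem gammaTail_le_one (n : ℕ) {x : ℝ} (hx : 0 ≤ x) : gammaTail n x ≤ 1 := by
  rw [← gammaTail_zero_right n]
  exact (strictAntiOn_gammaTail n).antitoneOn (mem_Ici.2 le_rfl) hx hx

theorem hasDerivAt_neg_factorial_mul_gammaTail (n : ℕ) (x : ℝ) :
    HasDerivAt (fun y => -((n.factorial : ℝ) * gammaTail n y)) (x ^ n * Real.exp (-x)) x := by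
  refine ((hasDerivAt_gammaTail n x).const_mul (n.factorial : ℝ)).neg.congr_deriv ?_
  have : (n.factorial : ℝ) ≠ 0 := by positivity
  field_simp

theorem tendsto_neg_factorial_mul_gammaTail (n : ℕ) :
    Tendsto (fun y => -((n.factorial : ℝ) * gammaTail n y)) atTop (𝓝 0) := by
  simpa using ((tendsto_gammaTail n).const_mul (n.factorial : ℝ)).neg

theorem integrableOn_pow_mul_exp_neg (n : ℕ) {r : ℝ} (hr : 0 ≤ r) :
    IntegrableOn (fun s : ℝ => s ^ n * Real.exp (-s)) (Ioi r) :=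
  integrableOn_Ioi_deriv_of_nonneg' (fun x _ => hasDerivAt_neg_factorial_mul_gammaTail n x)
    (fun _ hx => mul_nonneg (pow_nonneg (hr.trans (mem_Ioi.1 hx).le) n) (Real.exp_pos _).le)
    (tendsto_neg_factorial_mul_gammaTail n)

theorem integral_Ioi_pow_mul_exp_neg (n : ℕ) {r : ℝ} (hr : 0 ≤ r) :
    ∫ s in Ioi r, s ^ n * Real.exp (-s) = n.factorial * gammaTail n r := by
  rw [integral_Ioi_of_hasDerivAt_of_nonneg'
    (fun x _ => hasDerivAt_neg_factorial_mul_gammaTail n x)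
    (fun _ hx => mul_nonneg (pow_nonneg (hr.trans (mem_Ioi.1 hx).le) n) (Real.exp_pos _).le)
    (tendsto_neg_factorial_mul_gammaTail n)]
  ring

theorem upperIncompleteGamma_natCast_add_one (n : ℕ) {r : ℝ} (hr : 0 ≤ r) :
    upperIncompleteGamma (n + 1) r = n.factorial * gammaTail n r := by
  rw [← integral_Ioi_pow_mul_exp_neg n hr, upperIncompleteGamma]
  simp

theorem upperIncompleteGamma_eq_iff (n : ℕ) {ν ζ : ℝ} (hν : 0 ≤ ν) :
    upperIncompleteGamma (n + 1) ν = ζ * Real.Gamma (n + 1) ↔ gammaTail n ν = ζ := by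
  have : (n.factorial : ℝ) ≠ 0 := by positivity
  rw [upperIncompleteGamma_natCast_add_one n hν, Real.Gamma_nat_eq_factorial, mul_comm,
    mul_left_inj' this]

theorem exists_gammaTail_eq (n : ℕ) {ζ : ℝ} (hζ0 : 0 < ζ) (hζ1 : ζ ≤ 1) :
    ∃ ν, 0 ≤ ν ∧ gammaTail n ν = ζ := by
  obtain ⟨b, hbζ, hb⟩ := (((tendsto_gammaTail n).eventually_lt_const hζ0).and
    (eventually_ge_atTop 0)).exists
  obtain ⟨ν, hν, h⟩ := intermediate_value_Icc' hb (continuous_gammaTail n).continuousOn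
    (show ζ ∈ Icc (gammaTail n b) (gammaTail n 0) from
      ⟨hbζ.le, by rwa [gammaTail_zero_right]⟩)
  exact ⟨ν, hν.1, h⟩

/-- The conditional mean of the Gamma distribution with shape `n + 1` above the level `r`. -/
noncomputable def gammaTailMean (n : ℕ) (r : ℝ) : ℝ :=
  (n + 1) * gammaTail (n + 1) r / gammaTail n r

theorem gammaTailMean_pos (n : ℕ) {r : ℝ} (hr : 0 ≤ r) : 0 < gammaTailMean n r := by
  have := gammaTail_pos n hr
  have := gammaTail_pos (n + 1) hr
  unfold gammaTailMean
  positivity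

theorem integral_Ioi_pow_mul_sub_gammaTailMean (n : ℕ) {r : ℝ} (hr : 0 ≤ r) :
    ∫ s in Ioi r, s ^ n * Real.exp (-s) * (s - gammaTailMean n r) = 0 := by
  have h : ∀ s : ℝ, s ^ n * Real.exp (-s) * (s - gammaTailMean n r) =
      s ^ (n + 1) * Real.exp (-s) - gammaTailMean n r * (s ^ n * Real.exp (-s)) :=
    fun s => by ring
  simp_rw [h]
  rw [integral_sub (integrableOn_pow_mul_exp_neg (n + 1) hr)
    ((integrableOn_pow_mul_exp_neg n hr).const_mul _), integral_const_mul,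
    integral_Ioi_pow_mul_exp_neg _ hr, integral_Ioi_pow_mul_exp_neg _ hr, gammaTailMean,
    Nat.factorial_succ]
  have := (gammaTail_pos n hr).ne'
  push_cast
  field_simp
  simp

/-- The exponentials cancel, leaving a rational function of `r` that can be estimated by hand. -/
theorem gammaTailMean_sub_one (n : ℕ) {r : ℝ} (hr : 0 ≤ r) :
    gammaTailMean n r - 1 = n + r ^ (n + 1) /
      (n.factorial * ∑ k ∈ Finset.range (n + 1), r ^ k / (k.factorial : ℝ)) := by
  have h1 := gammaTail_pos n hr
  have h2 : 0 < ∑ k ∈ Finset.range (n + 1), r ^ k / (k.factorial : ℝ) := by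
    unfold gammaTail at h1
    exact (pos_iff_pos_of_mul_pos h1).1 (Real.exp_pos _)
  have h3 : (n.factorial : ℝ) ≠ 0 := by positivity
  rw [gammaTailMean, gammaTail_succ]
  unfold gammaTail
  rw [Nat.factorial_succ]
  push_cast
  have := Real.exp_pos (-r)
  field_simp
  ring

theorem gammaTailMean_sub_one_le (n : ℕ) {r : ℝ} (hr : 0 ≤ r) :
    gammaTailMean n r - 1 ≤ n + r := by
  rw [gammaTailMean_sub_one n hr]
  have h3 : (0 : ℝ) < n.factorial := by positivity
  -- Only the top term `k = n` of the sum is kept.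
  have h : r ^ n ≤ n.factorial * ∑ k ∈ Finset.range (n + 1), r ^ k / (k.factorial : ℝ) := by
    rw [Finset.sum_range_succ, mul_add, mul_div_cancel₀ _ h3.ne']
    have : 0 ≤ ∑ k ∈ Finset.range n, r ^ k / (k.factorial : ℝ) :=
      Finset.sum_nonneg fun k _ => by positivity
    nlinarith
  have hnn : 0 ≤ n.factorial * ∑ k ∈ Finset.range (n + 1), r ^ k / (k.factorial : ℝ) :=
    (pow_nonneg hr n).trans h
  gcongr
  refine div_le_of_le_mul₀ hnn hr ?_
  rw [pow_succ, mul_comm]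
  gcongr

theorem gammaTailMean_mono (n : ℕ) {r t : ℝ} (hr : 0 ≤ r) (hrt : r ≤ t) :
    gammaTailMean n r ≤ gammaTailMean n t := by
  have ht := hr.trans hrt
  have key : r ^ (n + 1) * gammaTail n t * Real.exp t ≤ t ^ (n + 1) * gammaTail n r * Real.exp r := by
    have e : ∀ x, gammaTail n x * Real.exp x =
        ∑ k ∈ Finset.range (n + 1), x ^ k / (k.factorial : ℝ) := fun x => by
      rw [gammaTail, mul_right_comm, ← Real.exp_add]; simp
    rw [mul_assoc, mul_assoc, e, e, Finset.mul_sum, Finset.mul_sum]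
    -- Termwise, `rⁿ⁺¹ tᵏ ≤ tⁿ⁺¹ rᵏ` because `k ≤ n` and `r ≤ t`.
    refine Finset.sum_le_sum fun k hk => ?_
    have hk' : k ≤ n := Nat.lt_succ_iff.1 (Finset.mem_range.1 hk)
    obtain ⟨j, rfl⟩ := Nat.exists_eq_add_of_le hk'
    rw [← mul_div_assoc, ← mul_div_assoc]
    gcongr ?_ / _
    calc r ^ (k + j + 1) * t ^ k = r ^ (j + 1) * (r ^ k * t ^ k) := by ring
      _ ≤ t ^ (j + 1) * (r ^ k * t ^ k) := by gcongr
      _ = t ^ (k + j + 1) * r ^ k := by ring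
  have h1 := gammaTail_pos n hr
  have h2 := gammaTail_pos n ht
  rw [gammaTailMean, gammaTailMean, div_le_div_iff₀ h1 h2, gammaTail_succ, gammaTail_succ]
  have hc : (0 : ℝ) < (n + 1).factorial := by positivity
  have key2 : Real.exp (-r) * r ^ (n + 1) * gammaTail n t ≤
      Real.exp (-t) * t ^ (n + 1) * gammaTail n r := by
    have := mul_le_mul_of_nonneg_left key (Real.exp_pos (-r - t)).le
    have er : Real.exp (-r - t) * Real.exp t = Real.exp (-r) := by rw [← Real.exp_add]; ring_nf
    have et : Real.exp (-r - t) * Real.exp r = Real.exp (-t) := by rw [← Real.exp_add]; ring_nf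
    calc _ = Real.exp (-r - t) * (r ^ (n + 1) * gammaTail n t * Real.exp t) := by rw [← er]; ring
      _ ≤ _ := this
      _ = _ := by rw [← et]; ring
  have key3 := div_le_div_of_nonneg_right key2 hc.le
  have hn : (0 : ℝ) ≤ n + 1 := by positivity
  have := mul_le_mul_of_nonneg_left key3 hn
  calc _ = (n + 1) * (gammaTail n r * gammaTail n t) + (n + 1) *
        (Real.exp (-r) * r ^ (n + 1) * gammaTail n t / (n + 1).factorial) := by ring
    _ ≤ (n + 1) * (gammaTail n r * gammaTail n t) + (n + 1) *
        (Real.exp (-t) * t ^ (n + 1) * gammaTail n r / (n + 1).factorial) := by linarith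
    _ = _ := by ring

/-- Chernoff bound for the Gamma tail at `e n`. -/
theorem gammaTail_exp_one_mul_le (n : ℕ) :
    gammaTail n (Real.exp 1 * n) ≤ Real.exp (-((Real.exp 1 - 2) * n)) := by
  have h : ∑ k ∈ Finset.range (n + 1), (Real.exp 1 * n) ^ k / (k.factorial : ℝ) ≤
      Real.exp n * Real.exp n := by
    calc _ ≤ ∑ k ∈ Finset.range (n + 1), Real.exp n * ((n : ℝ) ^ k / (k.factorial : ℝ)) := by
          -- Here `eᵏ ≤ eⁿ`; the remaining sum is a partial sum of the series of `eⁿ`.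
          refine Finset.sum_le_sum fun k hk => ?_
          have hk' : k ≤ n := Nat.lt_succ_iff.1 (Finset.mem_range.1 hk)
          rw [mul_pow, ← Real.exp_nat_mul, mul_one, mul_div_assoc]
          gcongr
      _ = Real.exp n * ∑ k ∈ Finset.range (n + 1), ((n : ℝ) ^ k / (k.factorial : ℝ)) := by
          rw [Finset.mul_sum]
      _ ≤ _ := by
          gcongr
          exact Real.sum_le_exp_of_nonneg (Nat.cast_nonneg n) (n + 1)
  calc _ ≤ Real.exp (-(Real.exp 1 * n)) * (Real.exp n * Real.exp n) := by
        unfold gammaTail; gcongr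
    _ = _ := by rw [← Real.exp_add, ← Real.exp_add]; ring_nf

theorem gammaTailMean_exp_one_mul_le {n : ℕ} (hn : 3 ≤ n) :
    gammaTailMean n (Real.exp 1 * n) - 1 ≤ (1 + Real.exp 1 * Real.log 2) * n := by
  obtain ⟨m, rfl⟩ := Nat.exists_eq_add_of_le' (show 2 ≤ n by omega)
  have hm : (1 : ℝ) ≤ m := by exact_mod_cast (show 1 ≤ m by omega)
  set N : ℝ := ((m + 2 : ℕ) : ℝ) with hN
  have hN' : N = m + 2 := by simp [hN]
  set e := Real.exp 1 with he
  have he1 := Real.exp_one_gt_d9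
  have he2 := Real.exp_one_lt_d9
  have hl := Real.log_two_gt_d9
  have hNpos : 0 < N := by linarith
  have hepos : 0 < e := Real.exp_pos 1
  have hr : 0 ≤ e * N := by positivity
  rw [gammaTailMean_sub_one _ hr]
  have hf : (0 : ℝ) < m.factorial := by positivity
  -- The last three terms of the sum suffice: as `N → ∞` they give `e² / (e² + e + 1) ≈ 0.665`,
  -- below `log 2 ≈ 0.693`. The inequality already holds at `N = 3`, but narrowly.
  have hlow : (e * N) ^ m * ((e * N) ^ 2 + N * (e * N) + N * (N - 1)) ≤
      (m + 2).factorial * ∑ k ∈ Finset.range (m + 2 + 1), (e * N) ^ k / (k.factorial : ℝ) := by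
    rw [Finset.sum_range_succ, Finset.sum_range_succ, Finset.sum_range_succ]
    have : 0 ≤ ∑ k ∈ Finset.range m, (e * N) ^ k / (k.factorial : ℝ) :=
      Finset.sum_nonneg fun k _ => by positivity
    have h0 : 0 ≤ ((m + 2).factorial : ℝ) * ∑ k ∈ Finset.range m, (e * N) ^ k / (k.factorial : ℝ) :=
      by positivity
    have h1 : ((m + 2).factorial : ℝ) * ((e * N) ^ m / (m.factorial : ℝ)) =
        (e * N) ^ m * (N * (N - 1)) := by
      rw [Nat.factorial_succ, Nat.factorial_succ, hN']; push_cast; field_simp; ring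
    have h2 : ((m + 2).factorial : ℝ) * ((e * N) ^ (m + 1) / ((m + 1).factorial : ℝ)) =
        (e * N) ^ m * (N * (e * N)) := by
      rw [Nat.factorial_succ (m + 1), hN']; push_cast; field_simp; ring
    have h3 : ((m + 2).factorial : ℝ) * ((e * N) ^ (m + 2) / ((m + 2).factorial : ℝ)) =
        (e * N) ^ m * (e * N) ^ 2 := by
      rw [mul_div_cancel₀ _ (by positivity), pow_add]
    have hdist : ∀ F S a b c : ℝ, F * (S + a + b + c) = F * S + F * a + F * b + F * c :=
      fun F S a b c => by ring
    rw [hdist, h1, h2, h3]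
    linarith
  have hD : 0 < (e * N) ^ 2 + N * (e * N) + N * (N - 1) := by
    have : 0 < N * (N - 1) := mul_pos hNpos (by linarith)
    positivity
  have hq : (e * N) ^ (m + 2 + 1) / ((m + 2).factorial *
      ∑ k ∈ Finset.range (m + 2 + 1), (e * N) ^ k / (k.factorial : ℝ)) ≤
      (e * N) ^ 3 / ((e * N) ^ 2 + N * (e * N) + N * (N - 1)) := by
    calc _ ≤ (e * N) ^ (m + 2 + 1) /
          ((e * N) ^ m * ((e * N) ^ 2 + N * (e * N) + N * (N - 1))) := by
            gcongr
      _ = _ := by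
        have : (e * N) ^ m ≠ 0 := by positivity
        rw [show m + 2 + 1 = m + 3 by rfl, pow_add, mul_div_mul_left _ _ this]
  have hfin : (e * N) ^ 3 / ((e * N) ^ 2 + N * (e * N) + N * (N - 1)) ≤ e * Real.log 2 * N := by
    rw [div_le_iff₀ hD]
    have hk : N * (e ^ 2) ≤ Real.log 2 * (e ^ 2 * N + e * N + (N - 1)) := by
      have hN3 : 3 ≤ N := by linarith
      have hA : N * (e ^ 2) ≤ 0.693 * (e ^ 2 * N + e * N + (N - 1)) := by
        nlinarith [mul_pos hNpos hepos]
      refine hA.trans ?_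
      have : 0 ≤ e ^ 2 * N + e * N + (N - 1) := by nlinarith [mul_pos hNpos hepos, sq_nonneg e]
      exact mul_le_mul_of_nonneg_right (by linarith) this
    have : 0 ≤ e * N * N := by positivity
    nlinarith [mul_le_mul_of_nonneg_left hk this]
  calc _ ≤ N + e * Real.log 2 * N := by linarith
    _ = _ := by ring

/-- The right-hand side is `(e + log₂ e) n` bits expressed in nats. As the conditional mean is
monotone, it is enough to find some `t ≥ ν` where the bound holds. -/
theorem gammaTailMean_sub_one_le_of_exp_le {n : ℕ} (hn : 1 ≤ n) {ν : ℝ} (hν : 0 ≤ ν)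
    (h : Real.exp (-((Real.exp 1 - 2) * n)) ≤ gammaTail n ν) :
    gammaTailMean n ν - 1 ≤ (1 + Real.exp 1 * Real.log 2) * n := by
  have he1 := Real.exp_one_gt_d9
  have he2 := Real.exp_one_lt_d9
  have hl := Real.log_two_gt_d9
  have hel : 1.88 ≤ Real.exp 1 * Real.log 2 := by nlinarith
  suffices H : ∃ t, 0 ≤ t ∧ gammaTail n t ≤ Real.exp (-((Real.exp 1 - 2) * n)) ∧
      gammaTailMean n t - 1 ≤ (1 + Real.exp 1 * Real.log 2) * n by
    obtain ⟨t, ht0, ht, ht'⟩ := H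
    have hνt : ν ≤ t := ((strictAntiOn_gammaTail n).le_iff_ge ht0 hν).1 (ht.trans h)
    linarith [gammaTailMean_mono n hν hνt]
  -- At `t = e n` the mean bound fails for `n = 1, 2`. The smaller points `2` and `5` still have a
  -- small enough tail; the sums there are `3` and `18.5`.
  rcases (show n = 1 ∨ n = 2 ∨ 3 ≤ n by omega) with rfl | rfl | hn3
  · refine ⟨2, by norm_num, ?_, ?_⟩
    · have h3 : (3 : ℝ) ≤ Real.exp (4 - Real.exp 1) := by
        have h5 : Real.exp (1 + 1 / 8) ≤ Real.exp (4 - Real.exp 1) :=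
          Real.exp_le_exp.2 (by linarith)
        have h6 : (1 : ℝ) + 1 / 8 ≤ Real.exp (1 / 8) := by
          linarith [Real.add_one_le_exp (1 / 8 : ℝ)]
        rw [Real.exp_add] at h5
        nlinarith
      have h4 : Real.exp (-((Real.exp 1 - 2) * (1 : ℕ))) =
          Real.exp (-2) * Real.exp (4 - Real.exp 1) := by
        rw [← Real.exp_add]; push_cast; ring_nf
      rw [h4, gammaTail]
      gcongr
      norm_num [Finset.sum_range_succ]
      exact h3
    · rw [gammaTailMean_sub_one _ (by norm_num)]
      norm_num [Finset.sum_range_succ]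
      linarith
  · refine ⟨5, by norm_num, ?_, ?_⟩
    · have h3 : (18.5 : ℝ) ≤ Real.exp (9 - 2 * Real.exp 1) := by
        have h5 : Real.exp (1 + 1 + 1) ≤ Real.exp (9 - 2 * Real.exp 1) :=
          Real.exp_le_exp.2 (by linarith)
        rw [Real.exp_add, Real.exp_add] at h5
        nlinarith [mul_pos (Real.exp_pos 1) (Real.exp_pos 1)]
      have h4 : Real.exp (-((Real.exp 1 - 2) * (2 : ℕ))) =
          Real.exp (-5) * Real.exp (9 - 2 * Real.exp 1) := by
        rw [← Real.exp_add]; push_cast; ring_nf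
      rw [h4, gammaTail]
      gcongr
      norm_num [Finset.sum_range_succ] at h3 ⊢
      exact h3
    · rw [gammaTailMean_sub_one _ (by norm_num)]
      norm_num [Finset.sum_range_succ, Nat.factorial]
      linarith
  · exact ⟨_, by positivity, gammaTail_exp_one_mul_le n, gammaTailMean_exp_one_mul_le hn3⟩

end GammaTail

/-! ### Log-concave densities: boundedness, integrability, growth of superlevel sets. -/

section LogConcaveDensity

open Filter Topology Set

variable {n : ℕ} {f : (Fin n → ℝ) → ℝ} {M : ℝ}

theorem LogConcave.exp_le (hlc : LogConcave f) {x y : Fin n → ℝ} (hx : 0 < f x) (hy : 0 < f y)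
    {a b : ℝ} (ha : 0 ≤ a) (hb : 0 ≤ b) (hab : a + b = 1) :
    Real.exp (a * Real.log (f x) + b * Real.log (f y)) ≤ f (a • x + b • y) := by
  have hpos : 0 < f (a • x + b • y) := hlc.1 hx hy ha hb hab
  rw [← Real.le_log_iff_exp_le hpos]
  exact hlc.2 hx hy ha hb hab

theorem homothety_eq (x y : Fin n → ℝ) (c : ℝ) :
    AffineMap.homothety x c y = (1 - c) • x + c • y := by
  ext i
  simp [AffineMap.homothety_apply]
  ring

theorem measureReal_image_homothety (x : Fin n → ℝ) {c : ℝ} (hc : 0 ≤ c) (s : Set (Fin n → ℝ)) :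
    volume.real (AffineMap.homothety x c '' s) = c ^ n * volume.real s := by
  simp only [measureReal_def, Measure.addHaar_image_homothety, Module.finrank_fin_fun,
    ENNReal.toReal_mul]
  rw [ENNReal.toReal_ofReal (abs_nonneg _), abs_of_nonneg (pow_nonneg hc n)]

theorem IsPdf.volume_lt_top (hf : IsPdf f) {a : ℝ} (ha : 0 < a) : volume {x | a < f x} < ⊤ :=
  hf.integrable.measure_gt_lt_top ha

theorem IsPdf.exists_volume_pos (hf : IsPdf f) : ∃ a, 0 < a ∧ 0 < volume.real {x | a < f x} := by
  have hpos : 0 < volume (Function.support f) := by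
    rw [← integral_pos_iff_support_of_nonneg hf.nonneg hf.integrable, hf.integral_eq_one]
    exact one_pos
  by_contra! h
  refine hpos.ne' (measure_mono_null (t := ⋃ k : ℕ, {x | 1 / ((k : ℝ) + 1) < f x}) ?_ ?_)
  · intro x hx
    obtain ⟨k, hk⟩ := exists_nat_one_div_lt ((hf.nonneg x).lt_of_ne' hx)
    exact mem_iUnion.2 ⟨k, hk⟩
  · refine measure_iUnion_null fun k => ?_
    have ha : (0 : ℝ) < 1 / ((k : ℝ) + 1) := by positivity
    have := le_antisymm (h _ ha) measureReal_nonneg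
    rwa [measureReal_def, ENNReal.toReal_eq_zero_iff, or_iff_left (hf.volume_lt_top ha).ne] at this

/-- Midpoints between `x` and `{f > a}` fill a set of volume `2⁻ⁿ v` on which `f ≥ √(a f(x))`. Total
mass `1` therefore caps `f x`. -/
theorem IsPdf.bddAbove_range (hf : IsPdf f) (hlc : LogConcave f) : BddAbove (range f) := by
  obtain ⟨a, ha, hv⟩ := hf.exists_volume_pos
  set v := volume.real {x | a < f x}
  set w : ℝ := (1 / 2) ^ n * v with hw
  have hwpos : 0 < w := by positivity
  refine ⟨1 / (a * w ^ 2), ?_⟩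
  rintro _ ⟨x, rfl⟩
  rcases (hf.nonneg x).eq_or_lt with hx | hx
  · rw [← hx]; positivity
  set b := Real.exp (1 / 2 * Real.log (f x) + 1 / 2 * Real.log a) with hb
  have hsub : AffineMap.homothety x (1 / 2 : ℝ) '' {x | a < f x} ⊆ {y | b ≤ f y} := by
    rintro _ ⟨y, hy, rfl⟩
    have hy' : a < f y := hy
    have h := hlc.exp_le hx (ha.trans hy') (a := 1 / 2) (b := 1 / 2) (by norm_num) (by norm_num)
      (by norm_num)
    rw [mem_ofPred_eq, homothety_eq, show (1 - 1 / 2 : ℝ) = 1 / 2 by norm_num]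
    refine le_trans ?_ h
    rw [hb]
    gcongr
  have hfin : volume {y | b ≤ f y} ≠ ⊤ := (hf.integrable.measure_ge_lt_top (Real.exp_pos _)).ne
  have h1 : w ≤ volume.real {y | b ≤ f y} := by
    rw [hw, ← measureReal_image_homothety x (by norm_num)]
    exact measureReal_mono hsub hfin
  have h2 : b * volume.real {y | b ≤ f y} ≤ 1 := by
    rw [← hf.integral_eq_one]
    exact mul_meas_ge_le_integral_of_nonneg (ae_of_all _ hf.nonneg) hf.integrable b
  have hbpos : 0 < b := Real.exp_pos _
  have h3 : b * w ≤ 1 := (mul_le_mul_of_nonneg_left h1 hbpos.le).trans h2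
  have h4 : b ^ 2 = f x * a := by
    rw [hb, ← Real.exp_nat_mul]
    have : ((2 : ℕ) : ℝ) * (1 / 2 * Real.log (f x) + 1 / 2 * Real.log a) =
        Real.log (f x) + Real.log a := by push_cast; ring
    rw [this, Real.exp_add, Real.exp_log hx, Real.exp_log ha]
  rw [le_div_iff₀ (by positivity)]
  calc f x * (a * w ^ 2) = (b * w) ^ 2 := by rw [mul_pow b w, h4]; ring
    _ ≤ 1 := pow_le_one₀ (by positivity) h3

theorem IsPdf.exists_isLUB (hf : IsPdf f) (hlc : LogConcave f) :
    ∃ M, 0 < M ∧ IsLUB (range f) M := by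
  have h := isLUB_csSup (range_nonempty f) (hf.bddAbove_range hlc)
  refine ⟨_, ?_, h⟩
  obtain ⟨a, ha, hv⟩ := hf.exists_volume_pos
  obtain ⟨x, hx⟩ : {x | a < f x}.Nonempty := by
    rw [nonempty_iff_ne_empty]
    intro h0
    simp [h0] at hv
  exact (ha.trans hx).trans_le (h.1 ⟨x, rfl⟩)

/-- Midpoint log-concavity gives `√(f x₀) √(f x) ≤ f ((x₀ + x) / 2)`, which is integrable in `x`.
The square root will dominate the entropy integrands. -/
theorem IsPdf.integrable_sqrt (hf : IsPdf f) (hlc : LogConcave f) :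
    Integrable fun x => √(f x) := by
  obtain ⟨M, hM, hlub⟩ := hf.exists_isLUB hlc
  obtain ⟨_, ⟨x₀, rfl⟩, hx₀, -⟩ := hlub.exists_between hM
  have hint : Integrable fun x => (√(f x₀))⁻¹ * f ((1 / 2 : ℝ) • x₀ + (1 / 2 : ℝ) • x) :=
    ((hf.integrable.comp_add_left ((1 / 2 : ℝ) • x₀)).comp_smul
      (by norm_num : (1 / 2 : ℝ) ≠ 0)).const_mul _
  refine hint.mono' (Real.continuous_sqrt.comp_aestronglyMeasurable hf.integrable.1) ?_
  refine ae_of_all _ fun x => ?_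
  rw [Real.norm_of_nonneg (Real.sqrt_nonneg _)]
  rcases (hf.nonneg x).eq_or_lt with hx | hx
  · rw [← hx, Real.sqrt_zero]
    exact mul_nonneg (by positivity) (hf.nonneg _)
  have h := hlc.exp_le hx₀ hx (a := 1 / 2) (b := 1 / 2) (by norm_num) (by norm_num) (by norm_num)
  have hs : ∀ t : ℝ, 0 < t → Real.exp (1 / 2 * Real.log t) = √t := fun t ht => by
    rw [Real.sqrt_eq_rpow, Real.rpow_def_of_pos ht, mul_comm]
  rw [Real.exp_add, hs _ hx₀, hs _ hx] at h
  rw [inv_mul_eq_div, le_div_iff₀ (Real.sqrt_pos.2 hx₀), mul_comm]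
  exact h

theorem Real.negMulLog_le_two_mul_sqrt {y : ℝ} (hy : 0 ≤ y) : Real.negMulLog y ≤ 2 * √y := by
  rcases hy.eq_or_lt with rfl | hy
  · simp
  have hs := Real.sqrt_pos.2 hy
  have h := Real.log_le_sub_one_of_pos (inv_pos.2 hs)
  rw [Real.log_inv, Real.log_sqrt hy.le] at h
  have h2 : y * (√y)⁻¹ = √y := by
    nth_rewrite 1 [← Real.mul_self_sqrt hy.le]
    field_simp
  have h3 := mul_le_mul_of_nonneg_left h hy.le
  rw [Real.negMulLog]
  nlinarith

/-- The volume of the superlevel set `{f > M e⁻ˢ}`. -/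
noncomputable def superlevelVolume (f : (Fin n → ℝ) → ℝ) (M s : ℝ) : ℝ :=
  volume.real {x | M * Real.exp (-s) < f x}

theorem superlevelVolume_nonneg (f : (Fin n → ℝ) → ℝ) (M s : ℝ) : 0 ≤ superlevelVolume f M s :=
  measureReal_nonneg

theorem IsPdf.superlevel_lt_top (hf : IsPdf f) (hM : 0 < M) (s : ℝ) :
    volume {x | M * Real.exp (-s) < f x} < ⊤ := hf.volume_lt_top (by positivity)

theorem IsPdf.monotone_superlevelVolume (hf : IsPdf f) (hM : 0 < M) :
    Monotone (superlevelVolume f M) := fun s t hst =>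
  measureReal_mono (fun x (hx : M * Real.exp (-s) < f x) => lt_of_le_of_lt (by gcongr) hx)
    (hf.superlevel_lt_top hM t).ne

/-- Superlevel sets of a log-concave density, dilated about its mode, have volumes at least
those that homogeneity predicts. -/
theorem IsPdf.superlevelVolume_mul_pow_le (hf : IsPdf f) (hlc : LogConcave f) (hM : 0 < M)
    (hlub : IsLUB (range f) M) {s t : ℝ} (ht : 0 < t) (hts : t ≤ s) :
    superlevelVolume f M s * t ^ n ≤ superlevelVolume f M t * s ^ n := by
  rcases hts.eq_or_lt with rfl | hts
  · exact le_rfl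
  have hs : 0 < s := ht.trans hts
  set c := t / s with hc
  have hcpos : 0 < c := by positivity
  have hc1 : c < 1 := (div_lt_one hs).2 hts
  -- The supremum `M` need not be attained, so the homothety is centred at a point with `f x₀ > M
  -- e^(-ε)`, its ratio is `d < t / s`, and `d → t / s` at the end. The choice of `ε` makes `(1 - d)
  -- ε + d s` exactly `t`.
  have key : ∀ d ∈ Ioo 0 c, d ^ n * superlevelVolume f M s ≤ superlevelVolume f M t := by
    rintro d ⟨hd0, hdc⟩
    have hd1 : 0 < 1 - d := by linarith
    obtain ⟨ε, hε⟩ : ∃ ε, ε = (c - d) * s / (1 - d) := ⟨_, rfl⟩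
    have hεpos : 0 < ε := by rw [hε]; exact div_pos (mul_pos (by linarith) hs) hd1
    have hε' : (1 - d) * ε + d * s = t := by
      rw [hε, mul_div_cancel₀ _ hd1.ne', sub_mul, hc, div_mul_cancel₀ _ hs.ne']; ring
    obtain ⟨_, ⟨x₀, rfl⟩, hx₀, -⟩ := hlub.exists_between
      (show M * Real.exp (-ε) < M from mul_lt_of_lt_one_right hM (by simpa using hεpos))
    rw [superlevelVolume, ← measureReal_image_homothety x₀ hd0.le]
    refine measureReal_mono ?_ (hf.superlevel_lt_top hM t).ne
    rintro _ ⟨y, hy, rfl⟩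
    have hy' : M * Real.exp (-s) < f y := hy
    have hpos : ∀ u, 0 < M * Real.exp (-u) := fun u => by positivity
    rw [mem_ofPred_eq, homothety_eq]
    refine lt_of_lt_of_le ?_ (hlc.exp_le ((hpos _).trans hx₀) ((hpos _).trans hy') hd1.le hd0.le
      (by ring))
    have hlog : ∀ u, Real.log (M * Real.exp (-u)) = Real.log M - u := fun u => by
      rw [Real.log_mul hM.ne' (Real.exp_pos _).ne', Real.log_exp]; ring
    rw [← Real.log_lt_iff_lt_exp (hpos t), hlog]
    have h1 := Real.log_lt_log (hpos _) hx₀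
    have h2 := Real.log_lt_log (hpos _) hy'
    rw [hlog] at h1 h2
    nlinarith [mul_lt_mul_of_pos_left h1 hd1, mul_lt_mul_of_pos_left h2 hd0]
  have hlim : c ^ n * superlevelVolume f M s ≤ superlevelVolume f M t := by
    have htend : Tendsto (fun d : ℝ => d ^ n * superlevelVolume f M s) (𝓝[<] c)
        (𝓝 (c ^ n * superlevelVolume f M s)) :=
      ((continuous_pow n).mul continuous_const).continuousWithinAt
    exact le_of_tendsto htend (mem_of_superset (Ioo_mem_nhdsLT hcpos) key)
  rw [hc, div_pow, div_mul_eq_mul_div, div_le_iff₀ (by positivity)] at hlim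
  linarith

end LogConcaveDensity

/-! ### Layer-cake formulas for mass and entropy. -/

section LayerCake

open Filter Topology Set

variable {n : ℕ} {f : (Fin n → ℝ) → ℝ} {M : ℝ}

/-- The density truncated at level `M e⁻ʳ` and divided by `M`. -/
noncomputable def normalizedTruncation (f : (Fin n → ℝ) → ℝ) (M r : ℝ) (x : Fin n → ℝ) : ℝ :=
  min (Real.exp (-r)) (f x / M)

theorem IsPdf.normalizedTruncation_nonneg (hf : IsPdf f) (hM : 0 < M) (r : ℝ) (x : Fin n → ℝ) :
    0 ≤ normalizedTruncation f M r x :=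
  le_min (Real.exp_pos _).le (div_nonneg (hf.nonneg x) hM.le)

theorem normalizedTruncation_le_one {r : ℝ} (hr : 0 ≤ r) (x : Fin n → ℝ) :
    normalizedTruncation f M r x ≤ 1 :=
  (min_le_left _ _).trans (by simpa using hr)

/-- Layer-cake formula: integrating a function of the truncated density amounts to integrating
its derivative, in the variable `s = -log (f / M)`, against the volumes of superlevel sets. -/
theorem IsPdf.lintegral_mul_superlevel (hf : IsPdf f) (hM : 0 < M) {k K H : ℝ → ℝ}
    (hk : Measurable k) (hk0 : ∀ s, 0 ≤ s → 0 ≤ k s)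
    (hki : ∀ b, 0 ≤ b → IntegrableOn k (Ioi b)) (hK : ∀ b, 0 ≤ b → ∫ s in Ioi b, k s = K b)
    (hH0 : H 0 = 0) (hH : ∀ b, 0 ≤ b → H (Real.exp (-b)) = K b) {r : ℝ} (hr : 0 ≤ r) :
    ∫⁻ s in Ioi r, ENNReal.ofReal (k s) * volume {x | M * Real.exp (-s) < f x} =
      ∫⁻ x, ENNReal.ofReal (H (normalizedTruncation f M r x)) := by
  set F : (Fin n → ℝ) → ℝ → ENNReal := fun x s =>
    {p : (Fin n → ℝ) × ℝ | M * Real.exp (-p.2) < f p.1}.indicator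
      (fun p => ENNReal.ofReal (k p.2)) (x, s) with hF
  have hfm : AEMeasurable f := hf.integrable.1.aemeasurable
  have hmeas : AEMeasurable (Function.uncurry F) (volume.prod (volume.restrict (Ioi r))) := by
    refine AEMeasurable.indicator₀ (hk.comp measurable_snd).ennreal_ofReal.aemeasurable ?_
    refine nullMeasurableSet_lt ?_ hf.integrable.1.comp_fst.aemeasurable
    exact (by fun_prop : Measurable fun p : (Fin n → ℝ) × ℝ => M * Real.exp (-p.2)).aemeasurable
  have hleft : ∀ s, ∫⁻ x, F x s =
      ENNReal.ofReal (k s) * volume {x | M * Real.exp (-s) < f x} := by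
    intro s
    have : (fun x => F x s) = {x | M * Real.exp (-s) < f x}.indicator
        (fun _ => ENNReal.ofReal (k s)) := by
      ext x
      simp only [hF, indicator_apply, mem_ofPred_eq]
    rw [this, lintegral_indicator_const₀ (nullMeasurableSet_lt aemeasurable_const hfm)]
  have hright : ∀ x, ∫⁻ s in Ioi r, F x s =
      ENNReal.ofReal (H (normalizedTruncation f M r x)) := by
    intro x
    -- Writing `f x / M = e⁻ᵘ`, the inner integral runs over `s > max r u`. The case `f x = 0` is `u
    -- = ∞`, which is where `H 0 = 0` enters.
    rcases (hf.nonneg x).eq_or_lt with hx | hx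
    · have h0 : normalizedTruncation f M r x = 0 := by
        rw [normalizedTruncation, ← hx, zero_div, min_eq_right (Real.exp_pos _).le]
      rw [h0, hH0, ENNReal.ofReal_zero]
      have : ∀ s, F x s = 0 := fun s => by
        simp only [hF]
        refine indicator_of_notMem ?_ _
        rw [mem_ofPred_eq, ← hx, not_lt]
        positivity
      simp [this]
    · set u := -Real.log (f x / M) with hu
      have hfu : f x / M = Real.exp (-u) := by
        rw [hu, neg_neg, Real.exp_log (div_pos hx hM)]
      have hmem : ∀ s, M * Real.exp (-s) < f x ↔ u < s := fun s => by
        rw [mul_comm, ← lt_div_iff₀ hM, hfu, Real.exp_lt_exp, neg_lt_neg_iff]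
      have hN : normalizedTruncation f M r x = Real.exp (-max r u) := by
        rw [normalizedTruncation, hfu, ← Real.exp_monotone.map_min, min_neg_neg]
      have hmax : 0 ≤ max r u := le_max_of_le_left hr
      have hFx : F x = (Ioi u).indicator (fun s => ENNReal.ofReal (k s)) := by
        ext s
        simp only [hF, indicator_apply, mem_ofPred_eq, mem_Ioi, hmem]
      rw [hN, hH _ hmax, hFx, lintegral_indicator measurableSet_Ioi,
        Measure.restrict_restrict measurableSet_Ioi, Ioi_inter_Ioi, sup_comm, ← hK _ hmax,
        ofReal_integral_eq_lintegral_ofReal (hki _ hmax)]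
      exact (ae_restrict_mem measurableSet_Ioi).mono fun s hs =>
        hk0 s (hmax.trans (mem_Ioi.1 hs).le)
  calc _ = ∫⁻ s in Ioi r, ∫⁻ x, F x s := by simp_rw [hleft]
    _ = ∫⁻ x, ∫⁻ s in Ioi r, F x s := (lintegral_lintegral_swap hmeas).symm
    _ = _ := by simp_rw [hright]

theorem IsPdf.integral_mul_superlevelVolume (hf : IsPdf f) (hM : 0 < M) {k K H : ℝ → ℝ}
    (hk : Measurable k) (hk0 : ∀ s, 0 ≤ s → 0 ≤ k s)
    (hki : ∀ b, 0 ≤ b → IntegrableOn k (Ioi b)) (hK : ∀ b, 0 ≤ b → ∫ s in Ioi b, k s = K b)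
    (hH0 : H 0 = 0) (hH : ∀ b, 0 ≤ b → H (Real.exp (-b)) = K b) {r : ℝ} (hr : 0 ≤ r)
    (hnn : ∀ x, 0 ≤ H (normalizedTruncation f M r x))
    (hint : Integrable fun x => H (normalizedTruncation f M r x)) :
    IntegrableOn (fun s => k s * superlevelVolume f M s) (Ioi r) ∧
      ∫ s in Ioi r, k s * superlevelVolume f M s = ∫ x, H (normalizedTruncation f M r x) := by
  have h := hf.lintegral_mul_superlevel hM hk hk0 hki hK hH0 hH hr
  have hnn' : 0 ≤ᵐ[volume.restrict (Ioi r)] fun s => k s * superlevelVolume f M s :=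
    (ae_restrict_mem measurableSet_Ioi).mono fun s hs =>
      mul_nonneg (hk0 s (hr.trans (mem_Ioi.1 hs).le)) (superlevelVolume_nonneg f M s)
  have hcongr : ∫⁻ s in Ioi r, ENNReal.ofReal (k s * superlevelVolume f M s) =
      ∫⁻ s in Ioi r, ENNReal.ofReal (k s) * volume {x | M * Real.exp (-s) < f x} := by
    refine setLIntegral_congr_fun measurableSet_Ioi fun s hs => ?_
    rw [ENNReal.ofReal_mul (hk0 s (hr.trans (mem_Ioi.1 hs).le)), superlevelVolume,
      ofReal_measureReal (hf.superlevel_lt_top hM s).ne]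
  have hm : Measurable fun s => k s * superlevelVolume f M s :=
    hk.mul (hf.monotone_superlevelVolume hM).measurable
  have hlt : ∫⁻ x, ENNReal.ofReal (H (normalizedTruncation f M r x)) < ⊤ :=
    hint.lintegral_lt_top
  refine ⟨⟨hm.aestronglyMeasurable, ?_⟩, ?_⟩
  · rw [hasFiniteIntegral_iff_ofReal hnn', hcongr, h]
    exact hlt
  · rw [integral_eq_lintegral_of_nonneg_ae hnn' hm.aestronglyMeasurable, hcongr, h,
      integral_eq_lintegral_of_nonneg_ae (ae_of_all _ hnn) hint.1]

theorem IsPdf.integrable_normalizedTruncation (hf : IsPdf f) (hM : 0 < M) (r : ℝ) :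
    Integrable (normalizedTruncation f M r) := by
  refine (hf.integrable.div_const M).mono' ?_ (ae_of_all _ fun x => ?_)
  · exact (aemeasurable_const.min (hf.integrable.1.aemeasurable.div_const M)).aestronglyMeasurable
  · rw [Real.norm_of_nonneg (hf.normalizedTruncation_nonneg hM r x)]
    exact min_le_right _ _

theorem IsPdf.integrable_negMulLog_normalizedTruncation (hf : IsPdf f) (hlc : LogConcave f)
    (hM : 0 < M) {r : ℝ} (hr : 0 ≤ r) :
    Integrable fun x => Real.negMulLog (normalizedTruncation f M r x) := by
  refine (((hf.integrable_sqrt hlc).div_const √M).const_mul 2).mono'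
    (Real.continuous_negMulLog.comp_aestronglyMeasurable
      (hf.integrable_normalizedTruncation hM r).1) (ae_of_all _ fun x => ?_)
  have h0 := hf.normalizedTruncation_nonneg hM r x
  rw [Real.norm_of_nonneg (Real.negMulLog_nonneg h0 (normalizedTruncation_le_one hr x)),
    ← Real.sqrt_div (hf.nonneg x)]
  refine (Real.negMulLog_le_two_mul_sqrt h0).trans ?_
  gcongr
  exact min_le_right _ _

theorem IsPdf.integral_exp_mul_superlevelVolume (hf : IsPdf f) (hM : 0 < M) {r : ℝ}
    (hr : 0 ≤ r) :
    IntegrableOn (fun s => Real.exp (-s) * superlevelVolume f M s) (Ioi r) ∧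
      ∫ s in Ioi r, Real.exp (-s) * superlevelVolume f M s =
        ∫ x, normalizedTruncation f M r x := by
  refine hf.integral_mul_superlevelVolume hM (K := fun b => Real.exp (-b)) (H := id)
    (by fun_prop) (fun s _ => (Real.exp_pos _).le) ?_ ?_ rfl (fun _ _ => rfl) hr
    (hf.normalizedTruncation_nonneg hM r) (hf.integrable_normalizedTruncation hM r)
  · intro b hb
    simpa using integrableOn_pow_mul_exp_neg 0 hb
  · intro b hb
    simpa [gammaTail_zero_left] using integral_Ioi_pow_mul_exp_neg 0 hb

theorem IsPdf.integral_mul_exp_mul_superlevelVolume (hf : IsPdf f) (hlc : LogConcave f)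
    (hM : 0 < M) {r : ℝ} (hr : 0 ≤ r) :
    IntegrableOn (fun s => s * Real.exp (-s) * superlevelVolume f M s) (Ioi r) ∧
      ∫ s in Ioi r, s * Real.exp (-s) * superlevelVolume f M s =
        (∫ x, normalizedTruncation f M r x) +
          ∫ x, Real.negMulLog (normalizedTruncation f M r x) := by
  have hi1 := hf.integrable_normalizedTruncation hM r
  have hi2 := hf.integrable_negMulLog_normalizedTruncation hlc hM hr
  rw [← integral_add hi1 hi2]
  -- `∫_b^∞ s e⁻ˢ ds = (1 + b) e⁻ᵇ`, which is `y - y log y` at `y = e⁻ᵇ`.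
  refine hf.integral_mul_superlevelVolume hM (k := fun s => s * Real.exp (-s))
    (K := gammaTail 1) (H := fun y => y + Real.negMulLog y)
    (by fun_prop) (fun s hs => mul_nonneg hs (Real.exp_pos _).le) ?_ ?_ (by simp) ?_ hr
    ?_ (hi1.add hi2)
  · intro b hb
    simpa using integrableOn_pow_mul_exp_neg 1 hb
  · intro b hb
    simpa using integral_Ioi_pow_mul_exp_neg 1 hb
  · intro b _
    simp [gammaTail, Finset.sum_range_succ, Real.negMulLog]
    ring
  · intro x
    have h0 := hf.normalizedTruncation_nonneg hM r x
    exact add_nonneg h0 (Real.negMulLog_nonneg h0 (normalizedTruncation_le_one hr x))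

end LayerCake

/-! ### Comparison with the Gamma law by single crossing. -/

section GammaComparison

open Filter Topology Set

variable {n : ℕ} {v : ℝ → ℝ} {r : ℝ}

/-- If `v(s) / sⁿ` is antitone, the law with density proportional to `v(s) e⁻ˢ` on `(0, ∞)` has
a lighter tail than the Gamma distribution with shape `n + 1`. -/
theorem integral_Ioi_le_gammaTail_mul
    (hv : ∀ s t, 0 < t → t ≤ s → v s * t ^ n ≤ v t * s ^ n)
    (hint : IntegrableOn (fun s => Real.exp (-s) * v s) (Ioi 0)) (hr : 0 ≤ r) :
    ∫ s in Ioi r, Real.exp (-s) * v s ≤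
      gammaTail n r * ∫ s in Ioi 0, Real.exp (-s) * v s := by
  rcases hr.eq_or_lt with rfl | hr0
  · rw [gammaTail_zero_right, one_mul]
  -- With this `w`, `v` lies above `w sⁿ` before `r` and below it after.
  set w := v r / r ^ n with hw
  have hpow := integrableOn_pow_mul_exp_neg n le_rfl
  have hsplit : ∀ {g : ℝ → ℝ}, IntegrableOn g (Ioi 0) →
      ∫ s in Ioi 0, g s = (∫ s in Ioc 0 r, g s) + ∫ s in Ioi r, g s := fun {g} hg => by
    rw [← Ioc_union_Ioi_eq_Ioi hr, setIntegral_union (Ioc_disjoint_Ioi le_rfl) measurableSet_Ioi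
      (hg.mono_set Ioc_subset_Ioi_self) (hg.mono_set (Ioi_subset_Ioi hr))]
  have hG := hsplit hpow
  rw [integral_Ioi_pow_mul_exp_neg n le_rfl, integral_Ioi_pow_mul_exp_neg n hr,
    gammaTail_zero_right, mul_one] at hG
  have hupper : ∫ s in Ioi r, Real.exp (-s) * v s ≤ w * (n.factorial * gammaTail n r) := by
    rw [← integral_Ioi_pow_mul_exp_neg n hr, ← integral_const_mul]
    refine setIntegral_mono_on (hint.mono_set (Ioi_subset_Ioi hr))
      ((integrableOn_pow_mul_exp_neg n hr).const_mul w) measurableSet_Ioi fun s hs => ?_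
    have : v s ≤ w * s ^ n := by
      rw [hw, div_mul_eq_mul_div, le_div_iff₀ (by positivity)]
      exact hv s r hr0 (mem_Ioi.1 hs).le
    calc _ ≤ Real.exp (-s) * (w * s ^ n) := by gcongr
      _ = _ := by ring
  have hlower : w * ∫ s in Ioc 0 r, s ^ n * Real.exp (-s) ≤
      ∫ s in Ioc 0 r, Real.exp (-s) * v s := by
    rw [← integral_const_mul]
    refine setIntegral_mono_on ((hpow.mono_set Ioc_subset_Ioi_self).const_mul w)
      (hint.mono_set Ioc_subset_Ioi_self) measurableSet_Ioc fun s hs => ?_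
    have : w * s ^ n ≤ v s := by
      rw [hw, div_mul_eq_mul_div, div_le_iff₀ (by positivity)]
      exact hv r s hs.1 hs.2
    calc _ = Real.exp (-s) * (w * s ^ n) := by ring
      _ ≤ _ := by gcongr
  rw [hsplit hint]
  -- For `q = gammaTail n r`, upper part `U` and lower part `L`: `(1 - q) U ≤ w n! q (1 - q) ≤ q L`,
  -- hence `U ≤ q (U + L)`.
  have hq0 := (gammaTail_pos n hr).le
  have hq1 : 0 ≤ 1 - gammaTail n r := sub_nonneg.2 (gammaTail_le_one n hr)
  have h1 := mul_le_mul_of_nonneg_left hupper hq1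
  have h2 := mul_le_mul_of_nonneg_left hlower hq0
  have h3 : ∫ s in Ioc 0 r, s ^ n * Real.exp (-s) = n.factorial * (1 - gammaTail n r) := by
    linarith
  rw [h3] at h2
  linarith

/-- If `v(s) / sⁿ` is antitone, the law with density proportional to `v(s) e⁻ˢ` on `(r, ∞)` has
at most the mean of the Gamma distribution with shape `n + 1` conditioned to exceed `r`. -/
theorem integral_Ioi_mul_le_gammaTailMean_mul
    (hv : ∀ s t, 0 < t → t ≤ s → v s * t ^ n ≤ v t * s ^ n) (hr : 0 ≤ r)
    (hint0 : IntegrableOn (fun s => Real.exp (-s) * v s) (Ioi r))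
    (hint1 : IntegrableOn (fun s => s * Real.exp (-s) * v s) (Ioi r)) :
    ∫ s in Ioi r, s * Real.exp (-s) * v s ≤
      gammaTailMean n r * ∫ s in Ioi r, Real.exp (-s) * v s := by
  set c := gammaTailMean n r with hc
  have hcpos : 0 < c := gammaTailMean_pos n hr
  set w := v c / c ^ n with hw
  have hgint : IntegrableOn (fun s => s ^ n * Real.exp (-s) * (s - c)) (Ioi r) := by
    refine ((integrableOn_pow_mul_exp_neg (n + 1) hr).sub
      ((integrableOn_pow_mul_exp_neg n hr).const_mul c)).congr (ae_of_all _ fun s => ?_)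
    simp only [Pi.sub_apply]
    ring
  have hle : ∫ s in Ioi r, (s * Real.exp (-s) * v s - c * (Real.exp (-s) * v s)) ≤
      ∫ s in Ioi r, w * (s ^ n * Real.exp (-s) * (s - c)) := by
    refine setIntegral_mono_on (hint1.sub (hint0.const_mul c)) (hgint.const_mul w)
      measurableSet_Ioi fun s hs => ?_
    have hs0 : 0 < s := hr.trans_lt hs
    -- The crossing is placed at the Gamma conditional mean `c`, where `s - c` also changes sign;
    -- the right-hand side then integrates to `0`.
    have key : v s * (s - c) ≤ w * s ^ n * (s - c) := by
      rcases le_total c s with h | h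
      · refine mul_le_mul_of_nonneg_right ?_ (sub_nonneg.2 h)
        rw [hw, div_mul_eq_mul_div, le_div_iff₀ (by positivity)]
        exact hv s c hcpos h
      · refine mul_le_mul_of_nonpos_right ?_ (sub_nonpos.2 h)
        rw [hw, div_mul_eq_mul_div, div_le_iff₀ (by positivity)]
        exact hv c s hs0 h
    calc _ = Real.exp (-s) * (v s * (s - c)) := by ring
      _ ≤ Real.exp (-s) * (w * s ^ n * (s - c)) := by gcongr
      _ = _ := by ring
  rw [integral_sub hint1 (hint0.const_mul c), integral_const_mul, integral_const_mul, hc,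
    integral_Ioi_pow_mul_sub_gammaTailMean n hr, mul_zero] at hle
  linarith

end GammaComparison

/-! ### Truncation levels and the entropy gap. -/

section TruncatedEntropy

open Filter Topology Set

variable {n : ℕ} {f : (Fin n → ℝ) → ℝ} {M ζ : ℝ}

theorem IsPdf.exists_isTruncationLevel (hf : IsPdf f) (hM : 0 < M) (hfM : ∀ x, f x ≤ M)
    (hζ0 : 0 < ζ) (hζ1 : ζ ≤ 1) : ∃ ξ, IsTruncationLevel f ζ ξ := by
  have hcont : ContinuousOn (fun ξ => ∫ x, min ξ (f x)) (Icc 0 M) := by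
    refine continuousOn_of_dominated (bound := f)
      (fun ξ _ => (aemeasurable_const.min hf.integrable.1.aemeasurable).aestronglyMeasurable)
      (fun ξ hξ => ae_of_all _ fun x => ?_) hf.integrable
      (ae_of_all _ fun x => (continuous_id.min continuous_const).continuousOn)
    rw [Real.norm_of_nonneg (le_min hξ.1 (hf.nonneg x))]
    exact min_le_right _ _
  have h0 : ∫ x, min 0 (f x) = 0 := by simp [min_eq_left (hf.nonneg _)]
  have h1 : ∫ x, min M (f x) = 1 := by simp [min_eq_right (hfM _), hf.integral_eq_one]
  obtain ⟨ξ, hξ, h⟩ := intermediate_value_Icc hM.le hcont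
    (show ζ ∈ Icc (∫ x, min 0 (f x)) (∫ x, min M (f x)) by rw [h0, h1]; exact ⟨hζ0.le, hζ1⟩)
  refine ⟨ξ, hξ.1.lt_of_ne ?_, h⟩
  rintro rfl
  exact hζ0.ne' (h.symm.trans h0)

theorem exists_min_eq_mul_normalizedTruncation (hM : 0 < M) (hfM : ∀ x, f x ≤ M) {ξ : ℝ}
    (hξ : 0 < ξ) : ∃ r, 0 ≤ r ∧ ∀ x, min ξ (f x) = M * normalizedTruncation f M r x := by
  have hmul : ∀ r x, M * normalizedTruncation f M r x = min (M * Real.exp (-r)) (f x) :=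
    fun r x => by rw [normalizedTruncation, mul_min_of_nonneg _ _ hM.le, mul_div_cancel₀ _ hM.ne']
  rcases le_total ξ M with h | h
  · refine ⟨-Real.log (ξ / M), neg_nonneg.2 (Real.log_nonpos (by positivity)
      ((div_le_one hM).2 h)), fun x => ?_⟩
    rw [hmul, neg_neg, Real.exp_log (by positivity), mul_div_cancel₀ _ hM.ne']
  -- A level above `M` truncates nothing, so `r = 0` serves.
  · refine ⟨0, le_rfl, fun x => ?_⟩
    rw [hmul, neg_zero, Real.exp_zero, mul_one, min_eq_right ((hfM x).trans h),
      min_eq_right (hfM x)]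

theorem mul_normalizedTruncation_zero (hM : 0 < M) (hfM : ∀ x, f x ≤ M) (x : Fin n → ℝ) :
    M * normalizedTruncation f M 0 x = f x := by
  rw [normalizedTruncation, neg_zero, Real.exp_zero, min_eq_right ((div_le_one hM).2 (hfM x)),
    mul_div_cancel₀ _ hM.ne']

theorem entropyIntegrand_const_mul (c : ℝ) (y : (Fin n → ℝ) → ℝ) (x : Fin n → ℝ) :
    entropyIntegrand (fun x => c * y x) x =
      (y x * Real.negMulLog c + c * Real.negMulLog (y x)) / Real.log 2 := by
  rw [← Real.negMulLog_mul, entropyIntegrand, Real.logb, Real.negMulLog]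
  ring

theorem integrable_entropyIntegrand_const_mul (c : ℝ) {y : (Fin n → ℝ) → ℝ} (hy : Integrable y)
    (hy' : Integrable fun x => Real.negMulLog (y x)) :
    Integrable (entropyIntegrand fun x => c * y x) := by
  rw [funext (entropyIntegrand_const_mul c y)]
  exact ((hy.mul_const _).add (hy'.const_mul c)).div_const _

theorem diffEntropy_const_mul (c : ℝ) {y : (Fin n → ℝ) → ℝ} (hy : Integrable y)
    (hy' : Integrable fun x => Real.negMulLog (y x)) :
    diffEntropy (fun x => c * y x) * Real.log 2 =
      (∫ x, y x) * Real.negMulLog c + c * ∫ x, Real.negMulLog (y x) := by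
  rw [diffEntropy, funext (entropyIntegrand_const_mul c y), integral_div,
    integral_add (hy.mul_const _) (hy'.const_mul c), integral_mul_const, integral_const_mul,
    div_mul_cancel₀ _ (Real.log_pos one_lt_two).ne']

theorem IsPdf.integrable_entropyIntegrand (hf : IsPdf f) (hlc : LogConcave f) :
    Integrable (entropyIntegrand f) := by
  obtain ⟨M, hM, hlub⟩ := hf.exists_isLUB hlc
  have h := integrable_entropyIntegrand_const_mul M (hf.integrable_normalizedTruncation hM 0)
    (hf.integrable_negMulLog_normalizedTruncation hlc hM le_rfl)
  rwa [funext (mul_normalizedTruncation_zero hM fun x => hlub.1 ⟨x, rfl⟩)] at h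

/-- Rescaling by `M` leaves the remainder `M ∫ -(f/M) log (f/M)`, which is nonnegative as `f / M ≤
1`. -/
theorem IsPdf.neg_log_le_diffEntropy (hf : IsPdf f) (hlc : LogConcave f) (hM : 0 < M)
    (hfM : ∀ x, f x ≤ M) : -Real.log M ≤ diffEntropy f * Real.log 2 := by
  have h := diffEntropy_const_mul M (hf.integrable_normalizedTruncation hM 0)
    (hf.integrable_negMulLog_normalizedTruncation hlc hM le_rfl)
  have hmass : (∫ x, normalizedTruncation f M 0 x) = M⁻¹ := by
    refine eq_inv_of_mul_eq_one_right ?_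
    rw [← integral_const_mul]
    simp_rw [mul_normalizedTruncation_zero hM hfM]
    exact hf.integral_eq_one
  rw [funext (mul_normalizedTruncation_zero hM hfM), hmass, Real.negMulLog] at h
  have hnn : 0 ≤ ∫ x, Real.negMulLog (normalizedTruncation f M 0 x) :=
    integral_nonneg fun x => Real.negMulLog_nonneg (hf.normalizedTruncation_nonneg hM 0 x)
      (normalizedTruncation_le_one le_rfl x)
  have h1 : M⁻¹ * (-M * Real.log M) = -Real.log M := by field_simp
  rw [h, h1]
  nlinarith

theorem truncationLevel_spec (h : ∃ ξ, IsTruncationLevel f ζ ξ) :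
    IsTruncationLevel f ζ (truncationLevel f ζ) := by
  rw [truncationLevel, dif_pos h]
  exact h.choose_spec

theorem IsPdf.exists_truncatedDensity_eq (hf : IsPdf f) (hM : 0 < M) (hfM : ∀ x, f x ≤ M)
    (hζ0 : 0 < ζ) (hζ1 : ζ ≤ 1) :
    ∃ r, 0 ≤ r ∧ truncatedDensity f ζ = (fun x => M / ζ * normalizedTruncation f M r x) ∧
      M * ∫ x, normalizedTruncation f M r x = ζ := by
  obtain ⟨hξ, hmass⟩ := truncationLevel_spec (hf.exists_isTruncationLevel hM hfM hζ0 hζ1)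
  obtain ⟨r, hr, h⟩ := exists_min_eq_mul_normalizedTruncation hM hfM hξ
  refine ⟨r, hr, funext fun x => ?_, ?_⟩
  · rw [truncatedDensity, h]; ring
  · rw [← hmass, ← integral_const_mul]
    simp_rw [h]

theorem IsPdf.integrable_entropyIntegrand_truncatedDensity (hf : IsPdf f) (hlc : LogConcave f)
    (hζ0 : 0 < ζ) (hζ1 : ζ ≤ 1) : Integrable (entropyIntegrand (truncatedDensity f ζ)) := by
  obtain ⟨M, hM, hlub⟩ := hf.exists_isLUB hlc
  obtain ⟨r, hr, h, -⟩ := hf.exists_truncatedDensity_eq hM (fun x => hlub.1 ⟨x, rfl⟩) hζ0 hζ1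
  rw [h]
  exact integrable_entropyIntegrand_const_mul _ (hf.integrable_normalizedTruncation hM r)
    (hf.integrable_negMulLog_normalizedTruncation hlc hM hr)

/-- Truncation raises the entropy (in nats) of a log-concave density by at most
`log ζ + E[G | G > ν] - 1`, where `G` has the Gamma distribution with shape `n + 1` and
`P(G > ν) = ζ`. -/
theorem IsPdf.truncatedDiffEntropy_sub_le (hf : IsPdf f) (hlc : LogConcave f)
    (hζ0 : 0 < ζ) (hζ1 : ζ ≤ 1) {ν : ℝ} (hν : 0 ≤ ν) (hνζ : gammaTail n ν = ζ) :
    (truncatedDiffEntropy f ζ - diffEntropy f) * Real.log 2 ≤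
      Real.log ζ + (gammaTailMean n ν - 1) := by
  obtain ⟨M, hM, hlub⟩ := hf.exists_isLUB hlc
  have hfM : ∀ x, f x ≤ M := fun x => hlub.1 ⟨x, rfl⟩
  obtain ⟨r, hr, htr, hmass⟩ := hf.exists_truncatedDensity_eq hM hfM hζ0 hζ1
  have hv : ∀ s t, 0 < t → t ≤ s →
      superlevelVolume f M s * t ^ n ≤ superlevelVolume f M t * s ^ n :=
    fun s t ht hts => hf.superlevelVolume_mul_pow_le hlc hM hlub ht hts
  obtain ⟨hi0, he0⟩ := hf.integral_exp_mul_superlevelVolume hM le_rfl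
  obtain ⟨hir, her⟩ := hf.integral_exp_mul_superlevelVolume hM hr
  obtain ⟨hi1, he1⟩ := hf.integral_mul_exp_mul_superlevelVolume hlc hM hr
  have hmass0 : M * ∫ x, normalizedTruncation f M 0 x = 1 := by
    rw [← integral_const_mul]
    simp_rw [mul_normalizedTruncation_zero hM hfM]
    exact hf.integral_eq_one
  -- The tail comparison reads `P(G > ν) = ζ ≤ P(G > r)`.
  have hrν : r ≤ ν := by
    have h := mul_le_mul_of_nonneg_left (integral_Ioi_le_gammaTail_mul hv hi0 hr) hM.le
    rw [he0, her, hmass, mul_left_comm, hmass0, mul_one, ← hνζ] at h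
    exact ((strictAntiOn_gammaTail n).le_iff_ge hν hr).1 h
  have hmean := integral_Ioi_mul_le_gammaTailMean_mul hv hr hir hi1
  rw [he1, her] at hmean
  have hent := diffEntropy_const_mul (M / ζ) (hf.integrable_normalizedTruncation hM r)
    (hf.integrable_negMulLog_normalizedTruncation hlc hM hr)
  rw [← htr] at hent
  set A := ∫ x, normalizedTruncation f M r x
  set B := ∫ x, Real.negMulLog (normalizedTruncation f M r x)
  have hA : A = ζ / M := by rw [eq_div_iff hM.ne', mul_comm]; exact hmass
  -- The first moment is `A + B` and `M A = ζ`; this is the source of the `-1`.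
  have hB : M / ζ * B ≤ gammaTailMean n r - 1 := by
    have h1 : B ≤ (gammaTailMean n r - 1) * (ζ / M) := by rw [← hA]; linarith
    rw [div_mul_eq_mul_div, div_le_iff₀ hζ0]
    calc M * B ≤ M * ((gammaTailMean n r - 1) * (ζ / M)) := by gcongr
      _ = _ := by field_simp
  have hlog : A * Real.negMulLog (M / ζ) = Real.log ζ - Real.log M := by
    rw [hA, Real.negMulLog, Real.log_div hM.ne' hζ0.ne']
    field_simp
    ring
  have hlow := hf.neg_log_le_diffEntropy hlc hM hfM
  have hmono := gammaTailMean_mono n hr hrν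
  rw [truncatedDiffEntropy, sub_mul, hent, hlog]
  linarith

end TruncatedEntropy

theorem lemma4 (n : ℕ) (hn : 1 ≤ n) (f : (Fin n → ℝ) → ℝ) (hf : IsPdf f) (hlc : LogConcave f)
    (ζ : ℝ) (hζ0 : 0 < ζ) (hζ1 : ζ ≤ 1) :
    -- the quantities in the claim are well defined
    (∃ ξ, IsTruncationLevel f ζ ξ) ∧
    MeasureTheory.Integrable (entropyIntegrand f) ∧
    MeasureTheory.Integrable (entropyIntegrand (truncatedDensity f ζ)) ∧
    (∃ ν : ℝ, 0 ≤ ν ∧ upperIncompleteGamma (n + 1) ν = ζ * Real.Gamma (n + 1)) ∧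
    -- the bound in terms of the incomplete gamma function
    (∀ ν : ℝ, 0 ≤ ν → upperIncompleteGamma (n + 1) ν = ζ * Real.Gamma (n + 1) →
      truncatedDiffEntropy f ζ - diffEntropy f ≤
        Real.logb 2 ζ + ν * Real.logb 2 (Real.exp 1) + n * Real.logb 2 (Real.exp 1)) ∧
    -- the explicit bound
    (Real.exp (-((Real.exp 1 - 2) * n)) ≤ ζ →
      truncatedDiffEntropy f ζ - diffEntropy f ≤
        Real.logb 2 ζ + (Real.exp 1 + Real.logb 2 (Real.exp 1)) * n) := by

  obtain ⟨M, hM, hlub⟩ := hf.exists_isLUB hlc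
  have hlog2 : 0 < Real.log 2 := Real.log_pos one_lt_two
  have hlogb : Real.logb 2 (Real.exp 1) = 1 / Real.log 2 := by rw [Real.logb, Real.log_exp]
  obtain ⟨ν₀, hν₀, hνζ₀⟩ := exists_gammaTail_eq n hζ0 hζ1
  refine ⟨hf.exists_isTruncationLevel hM (fun x => hlub.1 ⟨x, rfl⟩) hζ0 hζ1,
    hf.integrable_entropyIntegrand hlc,
    hf.integrable_entropyIntegrand_truncatedDensity hlc hζ0 hζ1,
    ⟨ν₀, hν₀, (upperIncompleteGamma_eq_iff n hν₀).2 hνζ₀⟩, fun ν hν hνζ => ?_, fun hζ => ?_⟩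
  · have h := hf.truncatedDiffEntropy_sub_le hlc hζ0 hζ1 hν
      ((upperIncompleteGamma_eq_iff n hν).1 hνζ)
    have h' := gammaTailMean_sub_one_le n hν
    rw [← le_div_iff₀ hlog2] at h
    refine h.trans ?_
    rw [hlogb, Real.logb, div_le_iff₀ hlog2]
    field_simp
    linarith
  · have h := hf.truncatedDiffEntropy_sub_le hlc hζ0 hζ1 hν₀ hνζ₀
    have h' := gammaTailMean_sub_one_le_of_exp_le hn hν₀ (hζ.trans_eq hνζ₀.symm)
    rw [← le_div_iff₀ hlog2] at h
    refine h.trans ?_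
    rw [hlogb, Real.logb, div_le_iff₀ hlog2]
    field_simp
    linarith
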